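/- **Setting.** An mDAG $\mathcal{G}$ has a finite set $V$ of random vertices, a finite set $W$ of fixed vertices (disjoint from $V$), directed edges forming an acyclic graph on $V\cup W$ in which no vertex of $W$ has a parent, and a set $\mathcal{B}$ of bidirected hyper-edges, which are subsets of $V$ of size at least two, none contained in another. Write $\mathrm{pa}(v)$ for the set of parents of $v$, $\mathrm{pa}(C)=\bigcup_{v\in C}\mathrm{pa}(v)$ and $\mathrm{sterile}(C)=C\setminus\mathrm{pa}(C)$. A set $C\subseteq V$ is *bidirected-connected* if any two distinct elements of $C$ are joined by a sequence of vertices in $C$ whose consecutive pairs each lie in some bidirected edge; $\mathcal{G}$ is *single-district* if $V$ is bidirected-connected. A *gearing* is an enumeration $B_1,\dots,B_k$ of $\mathcal{B}$ without repetition such that for each $j>1$ there is $s<j$ with $B_j\cap\bigcup_{i<j}B_i=B_j\cap B_s$; $\mathcal{G}$ is *geared* if it has a gearing. Put $R_j=B_j\setminus\bigcup_{i<j}B_i$. For $v\in R_j$ let $\pi(v)=\bigcup\{R_i : i>j,\ v\in B_i\}$, and for $D\subseteq V$ let $\pi(D)=\bigcup_{v\in D}\pi(v)$. Each $v\in V\cup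 W$ has a finite state-space $\mathfrak{X}_v$ with at least two elements; $\mathfrak{X}_A=\prod_{a\in A}\mathfrak{X}_a$ and $\mathfrak{X}_{VW}=\mathfrak{X}_{V\cup W}$. Define recursively $\mathcal{F}_v=\{f:\mathfrak{X}_{\mathrm{pa}(v)}\times\mathcal{F}_{\pi(v)}\to\mathfrak{X}_v\}$ for $v\in V$, with $\mathcal{F}_D=\prod_{v\in D}\mathcal{F}_v$ for $D\subseteq V$. For $x\in\mathfrak{X}_{VW}$ let $$\Phi_i(f_{\pi(R_i)},x)=\{f_{R_i}\in\mathcal{F}_{R_i} : f_v(x_{\mathrm{pa}(v)},f_{\pi(v)})=x_v \text{ for each } v\in R_i\},$$ and for functions $\rho_i:\mathcal{F}_{R_i}\to\mathbb{R}$ let $\mathcal{P}[\rho_k,\dots,\rho_1]\in\mathbb{R}^{\mathfrak{X}_{VW}}$ be the vector with entries $$\mathcal{P}[\rho_k,\dots,\rho_1](x)=\sum_{f_{R_k}\in\Phi_k}\rho_k(f_{R_k})\cdots\sum_{f_{R_1}\in\Phi_1}\rho_1(f_{R_1}).$$ For $\varepsilon:\mathcal{F}_{R_i}\to\mathbb{R}$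 with $\sum_{f\in\mathcal{F}_{R_i}}\varepsilon(f)=0$ (a *degenerate* function of the single variable $f_{R_i}$) let $$D_i(\varepsilon)=\lim_{\eta\downarrow0}\eta^{-1}\bigl\{\mathcal{P}[1,\dots,1+\eta\varepsilon,\dots,1]-\mathcal{P}[1,\dots,1]\bigr\},$$ where $1+\eta\varepsilon$ stands in place of $\rho_i$, and let $T_i$ be the set of all such $D_i(\varepsilon)$. For $A\subseteq V\cup W$ let $\Lambda_A$ be the space of $p\in\mathbb{R}^{\mathfrak{X}_{VW}}$ such that $p(x)$ depends on $x_A$ only and, for each $a\in A$, the sum of $p(x)$ over $x_a\in\mathfrak{X}_a$ is zero for all fixed values of the other coordinates. **Lemma 5.5.** Let $\mathcal{G}$ be a single-district, geared mDAG with gearing $B_1,\dots,B_k$, let $C\subseteq V$ be bidirected-connected, and put $C_i=C\cap R_i$ and $I=\{i : C_i\neq\emptyset\}$. Suppose that $I$ is non-empty, and let $l$ be its minimal element. For each $i\in I$ let $A_i$ be a set with $\mathrm{sterile}(C_i)\subseteq A_i\subseteq C_i\cup\mathrm{pa}(C_i)$, and let $A=\bigtriangleup_{i\in I}A_i$ be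 the set of elements that belong to an odd number of the sets $A_i$, $i\in I$. Then $\Lambda_A\subseteq T_l$. -/

import Mathlib

open Filter Topology

universe u v w

/-- An mDAG with random vertices `V` and fixed vertices `W`: a conditional DAG (directed edges only
point into random vertices, so fixed vertices have no parents) together with a collection of
bidirected hyper-edges, which are subsets of `V` with at least two elements, none of them
contained in another. Finiteness of `V` and `W` is imposed where it is used. -/
structure MDAG (V : Type u) (W : Type v) where
  /-- `edge a b` means `a → b`. -/
  edge : V ⊕ W → V → Prop
  acyclic : ∀ a : V, ¬ Relation.TransGen (fun b c : V => edge (Sum.inl b) c) a a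
  /-- The bidirected hyper-edges. -/
  bidirected : Set (Set V)
  nontrivial_of_mem : ∀ B ∈ bidirected, B.Nontrivial
  maximal : IsAntichain (· ⊆ ·) bidirected

namespace MDAG

section Graph

variable {V : Type u} {W : Type v} (G : MDAG V W)

/-- The parents of a random vertex. -/
def pa (b : V) : Set (V ⊕ W) := {a | G.edge a b}

/-- The set of parents of the elements of `C` (it may meet `C`). -/
def paSet (C : Set V) : Set (V ⊕ W) := ⋃ b ∈ C, G.pa b

/-- The elements of `C` that have no children in `C`, as a set of vertices of the graph. -/
def sterile (C : Set V) : Set (V ⊕ W) := (Sum.inl '' C) \ G.paSet C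

/-- Any two vertices of `C` are joined by a sequence of vertices in `C` in which each pair of
consecutive vertices is contained in some bidirected edge. -/
def BidirectedConnected (C : Set V) : Prop :=
  ∀ a ∈ C, ∀ b ∈ C, Relation.ReflTransGen
    (fun c d : V => c ∈ C ∧ d ∈ C ∧ ∃ B ∈ G.bidirected, c ∈ B ∧ d ∈ B) a b

/-- A district is an inclusion-maximal bidirected-connected set; the graph has a single district
exactly when the set of all random vertices is bidirected-connected. -/
def SingleDistrict : Prop := G.BidirectedConnected Set.univ

/-- A gearing: an enumeration of the bidirected edges, without repetition, that satisfies
the running intersection property. The indices are `0, …, k - 1`. -/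
structure Gearing where
  k : ℕ
  B : Fin k → Set V
  injective : Function.Injective B
  range_eq : Set.range B = G.bidirected
  running : ∀ j : Fin k, 0 < j.val →
    ∃ s : Fin k, s < j ∧ B j ∩ (⋃ i : Fin k, ⋃ _ : i < j, B i) = B j ∩ B s

end Graph

namespace Gearing

section Functional

variable {V : Type u} {W : Type v} {G : MDAG V W} (g : G.Gearing)

/-- The remainder sets. -/
def R (j : Fin g.k) : Set V := g.B j \ ⋃ i : Fin g.k, ⋃ _ : i < j, g.B i

/-- `π(b)`: the union of the remainder sets `R i` over all edges `B i` that contain `b` and are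
later than `r(b)`, where `r(b)` is the index `j` with `b ∈ R j`. -/
def pi (b : V) : Set V := {c | ∃ i j : Fin g.k, j < i ∧ b ∈ g.R j ∧ b ∈ g.B i ∧ c ∈ g.R i}

/-- `π(C)`, the union of the sets `π(b)` for `b ∈ C`. -/
def piSet (C : Set V) : Set V := ⋃ b ∈ C, g.pi b

theorem R_unique {b : V} {i j : Fin g.k} (hi : b ∈ g.R i) (hj : b ∈ g.R j) : i = j := by
  rcases lt_trichotomy i j with h | h | h
  · exact absurd (Set.mem_iUnion₂.2 ⟨i, h, hi.1⟩) hj.2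
  · exact h
  · exact absurd (Set.mem_iUnion₂.2 ⟨j, h, hj.1⟩) hi.2

/-- The index `r(b)` as a natural number (`0` if `b` lies in no remainder set). -/
noncomputable def rank (b : V) : ℕ := sInf {n | ∃ j : Fin g.k, j.val = n ∧ b ∈ g.R j}

theorem rank_eq {b : V} {j : Fin g.k} (hj : b ∈ g.R j) : g.rank b = j.val := by
  have h : {n | ∃ j : Fin g.k, j.val = n ∧ b ∈ g.R j} = {j.val} := by
    ext n
    constructor
    · rintro ⟨i, rfl, hi⟩
      exact congrArg Fin.val (g.R_unique hi hj)
    · rintro rfl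
      exact ⟨j, rfl, hj⟩
  rw [rank, h, csInf_singleton]

theorem rank_decreasing {b c : V} (h : c ∈ g.pi b) : g.k - g.rank c < g.k - g.rank b := by
  obtain ⟨i, j, hij, hb, -, hc⟩ := h
  rw [g.rank_eq hb, g.rank_eq hc]
  have := i.isLt
  have : j.val < i.val := hij
  omega

/-- The recursively defined set of functions
`F_b = {f : X_{pa(b)} × F_{π(b)} → X_b}`, with `F_A` the product of the `F_a` for `a ∈ A`. -/
def Fn (X : V ⊕ W → Type w) (b : V) : Type (max u v w) :=
  ((∀ a : G.pa b, X a.1) × (∀ c : g.pi b, Fn X c.1)) → X (Sum.inl b)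
termination_by g.k - g.rank b
decreasing_by exact g.rank_decreasing c.2

/-- Elements of `F_b` are exactly the functions `X_{pa(b)} × F_{π(b)} → X_b`. -/
def fnEquiv (X : V ⊕ W → Type w) (b : V) :
    g.Fn X b ≃ (((∀ a : G.pa b, X a.1) × (∀ c : g.pi b, g.Fn X c.1)) → X (Sum.inl b)) :=
  Equiv.cast (by rw [Fn])

theorem finite_Fn [Finite V] [Finite W] (X : V ⊕ W → Type w) [∀ a, Finite (X a)] (b : V) :
    Finite (g.Fn X b) := by
  have : ∀ c : g.pi b, Finite (g.Fn X c.1) := fun c => finite_Fn X c.1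
  exact Finite.of_equiv _ (g.fnEquiv X b).symm
termination_by g.k - g.rank b
decreasing_by exact g.rank_decreasing c.2

/-- `F_A`, the set of families `(f_a)_{a ∈ A}` with `f_a ∈ F_a`. -/
abbrev FnSet (X : V ⊕ W → Type w) (A : Set V) : Type (max u v w) := ∀ a : A, g.Fn X a.1

noncomputable instance instFintypeFn [Finite V] [Finite W] (X : V ⊕ W → Type w)
    [∀ a, Finite (X a)] (b : V) : Fintype (g.Fn X b) :=
  have := g.finite_Fn X b
  Fintype.ofFinite _

noncomputable instance instFintypeFnSet [Finite V] [Finite W] (X : V ⊕ W → Type w)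
    [∀ a, Finite (X a)] (A : Set V) : Fintype (g.FnSet X A) :=
  Fintype.ofFinite _

variable (X : V ⊕ W → Type w)

/-- `Φ_i(f_{π(R_i)}, x_{VW})`: the families `f_{R_i}` such that
`f_b(x_{pa(b)}, f_{π(b)}) = x_b` for each `b ∈ R_i`. -/
def Phi (i : Fin g.k) (h : g.FnSet X (g.piSet (g.R i))) (x : ∀ a, X a) :
    Set (g.FnSet X (g.R i)) :=
  {f | ∀ b : g.R i, g.fnEquiv X b.1 (f b)
    (fun a => x a.1, fun c => h ⟨c.1, Set.mem_iUnion₂.2 ⟨b.1, b.2, c.2⟩⟩) = x (Sum.inl b.1)}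

/-- A weight `ρ_i` on the families `f_{R_i}` for each `i` (not necessarily normalized). -/
abbrev Weights := ∀ i : Fin g.k, g.FnSet X (g.R i) → ℝ

open Classical in
/-- The vector `P[ρ_k, …, ρ_1]`, indexed by `x_{VW}`: the iterated sum
`∑_{Φ_k} ρ_k ⋯ ∑_{Φ_1} ρ_1`, written as one sum over the families `f_V` with
`f_{R_i} ∈ Φ_i(f_{π(R_i)}, x_{VW})` for every `i`. -/
noncomputable def P [Fintype V] [Finite W] [∀ a, Finite (X a)] (ρ : g.Weights X)
    (x : ∀ a, X a) : ℝ :=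
  ∑ f : (∀ b : V, g.Fn X b) with
      ∀ i, (fun b : g.R i => f b.1) ∈ g.Phi X i (fun c => f c.1) x,
    ∏ i, ρ i (fun b => f b.1)

/-- Degenerate functions `ε_i` of the variable `U_i = f_{R_i}`, which takes its values in
`F_{R_i}`: the values of `ε_i` sum to zero, so that `1 + η ε_i` has the same total mass as `1`. -/
def Degenerate [Finite V] [Finite W] [∀ a, Finite (X a)] (i : Fin g.k)
    (ε : g.FnSet X (g.R i) → ℝ) : Prop :=
  ∑ f, ε f = 0

/-- `d = D_i(ε_i)`, the limit of `η⁻¹ (P[1, …, 1 + η ε_i, …, 1] - P[1, …, 1])` as `η ↓ 0`. -/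
def IsDirection [Fintype V] [Finite W] [∀ a, Finite (X a)] (i : Fin g.k)
    (ε : g.FnSet X (g.R i) → ℝ) (d : (∀ a, X a) → ℝ) : Prop :=
  Tendsto (fun η : ℝ => η⁻¹ •
      (g.P X (Function.update (1 : g.Weights X) i (1 + η • ε)) - g.P X 1))
    (𝓝[>] 0) (𝓝 d)

/-- `T_i`, the set of all `D_i(ε_i)` with `ε_i` degenerate. -/
def T [Fintype V] [Finite W] [∀ a, Finite (X a)] (i : Fin g.k) : Set ((∀ a, X a) → ℝ) :=
  {d | ∃ ε, g.Degenerate X i ε ∧ g.IsDirection X i ε d}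

end Functional

end Gearing

end MDAG

open Classical in
/-- `Λ_A`: the vectors `p` indexed by `x` in the product of the state-spaces such that the sum of
`p` over `x_a`, the other coordinates being fixed, is zero for each `a ∈ A`, and such that `p(x)`
depends on `x_A` only. -/
def Lam {N : Type u} (X : N → Type w) [∀ a, Fintype (X a)] (A : Set N) :
    Submodule ℝ ((∀ a, X a) → ℝ) where
  carrier := {p | (∀ a ∈ A, ∀ x : ∀ a, X a, ∑ y : X a, p (Function.update x a y) = 0) ∧
    ∀ x y : ∀ a, X a, (∀ a ∈ A, x a = y a) → p x = p y}
  add_mem' := by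
    rintro p q ⟨hp, hp'⟩ ⟨hq, hq'⟩
    refine ⟨fun a ha x => ?_, fun x y h => ?_⟩
    · simp [Finset.sum_add_distrib, hp a ha x, hq a ha x]
    · simp [hp' x y h, hq' x y h]
  zero_mem' := by simp
  smul_mem' := by
    rintro c p ⟨hp, hp'⟩
    refine ⟨fun a ha x => ?_, fun x y h => ?_⟩
    · simp [← Finset.mul_sum, hp a ha x]
    · simp [hp' x y h]

open Classical in
/-- The symmetric difference of the sets `A i` for `i ∈ I`: the elements that belong to an odd
number of them. -/
def bigSymmDiff {ι : Type u} {N : Type v} [Fintype ι] (I : Set ι) (A : ι → Set N) : Set N :=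
  {a | Odd (Finset.univ.filter (fun i => i ∈ I ∧ a ∈ A i)).card}

/-!
The difference quotients defining `D_l(ε)` are constant, so `D_l(ε)(x)` is the sum of `ε(f_{R_l})`
over all families `f` that agree with `x`, that is, `f_b(x_{pa(b)}, f_{π(b)}) = x_b` for all `b`
(`isDirection_sum_prod`). It is therefore enough to realise each `p ∈ Λ_A` as such a sum, for a
function `ε` of total mass zero.

The basic observation concerns one vertex `b`. Let `s` be a function on the state-space of `b` with
sum zero, `T` any function of the arguments `r = (y, h)` of `f_b`, and give `f_b` the weight
`∑_r s(f_b(r)) T(r)`. Summed over the `f_b` with the prescribed value `x_b` at one argument `q`,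
this weight yields `s(x_b) T(q)` up to a constant, because the values of `f_b` at the other
arguments are free (`card_mul_sum_ite_mul_sum`). Since `T` may depend on `f_{π(b)}`, it can contain
weights of the same kind for vertices of `π(b)`. By the running intersection property and the
connectedness of `C`, every vertex of `C` outside `R_l` lies in `π(d)` for some `d ∈ C`
(`exists_mem_pi`); choosing such an owner `d` for each of them makes `C` a forest with roots
`C ∩ R_l`. Nesting the weights along this forest and summing out the vertices in order of rank
realises every product `∏_{b ∈ C} s_b(x_b) t_b(x_{pa(b)})` with `∑ s_b = 0` and arbitrary `t_b`
(`sum_prod_agrees_mul_rootWeight`).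

The symmetric difference `A` satisfies `sterile(C) ⊆ A ⊆ C ∪ pa(C)`: a sterile vertex of `C` in
`R_i` lies in `A_i` and in no other `A_j`. A non-sterile vertex of `C` can be given a nowhere
vanishing `s_b`, which is divided out again in the factor `t` of one of its children, so that the
products above include centred point masses on `sterile(C)` times point masses on `pa(C)`. These
form a kernel that reproduces each `p ∈ Λ_A` up to a constant (`sum_prod_kernel_mul`), which
exhibits `p` as a linear combination of such products.
-/

open Function

/-! ### Sums over finite products and function spaces -/

section Averaging

/-- Resampling one coordinate of a point of a finite product leaves a sum over all points
unchanged, up to the number of values of the coordinate. -/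
theorem sum_sum_update {ι : Type*} [DecidableEq ι] {Y : ι → Type*} [Fintype (∀ i, Y i)] (i : ι)
    [Fintype (Y i)] (F : (∀ i, Y i) → ℝ) :
    ∑ z, ∑ y : Y i, F (update z i y) = Fintype.card (Y i) * ∑ z, F z := by
  let swap : (∀ i, Y i) × Y i → (∀ i, Y i) × Y i := fun q => (update q.1 i q.2, q.1 i)
  have hswap : Involutive swap := fun q => by simp [swap]
  calc ∑ z, ∑ y : Y i, F (update z i y)
      = ∑ q : (∀ i, Y i) × Y i, F (swap q).1 := by rw [Fintype.sum_prod_type]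
    _ = ∑ q : (∀ i, Y i) × Y i, F q.1 :=
        Equiv.sum_comp hswap.toPerm (fun q : (∀ i, Y i) × Y i => F q.1)
    _ = _ := by rw [Fintype.sum_prod_type, Finset.mul_sum]; simp

/-- Partial form of `sum_prod_kernel_mul`: the kernels act on the coordinates in `E` only. -/
theorem sum_prod_kernel_mul_piecewise {N : Type*} [Fintype N] [DecidableEq N] {X : N → Type*}
    [∀ a, Fintype (X a)] [∀ a, Nonempty (X a)] (κ : ∀ a, X a → X a → ℝ) (m : N → ℝ)
    (p : (∀ a, X a) → ℝ)
    (h : ∀ a x, ∑ y, κ a (x a) y * p (update x a y) = m a * p x) (x : ∀ a, X a) (E : Finset N) :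
    ∑ z : ∀ a, X a, (∏ a ∈ E, κ a (x a) (z a)) * p (E.piecewise z x) =
      Fintype.card (∀ a, X a) * (∏ a ∈ E, m a / Fintype.card (X a)) * p x := by
  induction E using Finset.induction_on with
  | empty => simp
  | insert a E ha ih =>
    have hn : (Fintype.card (X a) : ℝ) ≠ 0 := by simp
    refine mul_left_cancel₀ hn ?_
    rw [← sum_sum_update a]
    have key : ∀ z : ∀ a, X a, ∑ y : X a, (∏ b ∈ insert a E, κ b (x b) (update z a y b)) *
        p ((insert a E).piecewise (update z a y) x) =
        m a * ((∏ b ∈ E, κ b (x b) (z b)) * p (E.piecewise z x)) := by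
      intro z
      have hx : (E.piecewise z x) a = x a := Finset.piecewise_eq_of_notMem _ _ _ ha
      have := h a (E.piecewise z x)
      rw [hx] at this
      rw [mul_left_comm, ← this, Finset.mul_sum]
      refine Finset.sum_congr rfl fun y _ => ?_
      have h1 : E.piecewise (update z a y) x = E.piecewise z x := by
        refine E.piecewise_congr (fun b hb => ?_) fun _ _ => rfl
        rw [update_of_ne (ne_of_mem_of_not_mem hb ha)]
      have h2 : ∏ b ∈ E, κ b (x b) (update z a y b) = ∏ b ∈ E, κ b (x b) (z b) :=
        Finset.prod_congr rfl fun b hb => by rw [update_of_ne (ne_of_mem_of_not_mem hb ha)]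
      rw [Finset.prod_insert ha, h2, Finset.piecewise_insert, h1, update_self]
      ring
    rw [Finset.sum_congr rfl fun z _ => key z, ← Finset.mul_sum, ih, Finset.prod_insert ha]
    field_simp

/-- If `p` is an eigenvector, coordinate by coordinate, of the kernels `κ a`, then it is an
eigenvector of the product kernel. -/
theorem sum_prod_kernel_mul {N : Type*} [Fintype N] [DecidableEq N] {X : N → Type*}
    [∀ a, Fintype (X a)] [∀ a, Nonempty (X a)] (κ : ∀ a, X a → X a → ℝ) (m : N → ℝ)
    (p : (∀ a, X a) → ℝ)
    (h : ∀ a x, ∑ y, κ a (x a) y * p (update x a y) = m a * p x) (x : ∀ a, X a) :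
    ∑ z : ∀ a, X a, (∏ a, κ a (x a) (z a)) * p z = (∏ a, m a) * p x := by
  have := sum_prod_kernel_mul_piecewise κ m p h x Finset.univ
  simp only [Finset.piecewise_univ] at this
  rw [this, Finset.prod_div_distrib, Fintype.card_pi]
  have : (∏ a, (Fintype.card (X a) : ℝ)) ≠ 0 := Finset.prod_ne_zero_iff.2 fun a _ => by simp
  push_cast
  field_simp

open Classical in
theorem card_mul_sum_ite_eq {α β : Type*} [Fintype (α → β)] [Fintype β] (q : α) (c : β) :
    (Fintype.card β : ℝ) * ∑ φ : α → β, (if φ q = c then (1 : ℝ) else 0) =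
      Fintype.card (α → β) := by
  rw [← sum_sum_update q (fun φ : α → β => if φ q = c then (1 : ℝ) else 0)]
  simp

open Classical in
/-- Among the functions `φ` with a prescribed value at `q`, the values of `φ` at the other points
are uniformly distributed, so a weight with sum zero only sees the point `q`. -/
theorem card_mul_sum_ite_mul_sum {α β : Type*} [Fintype (α → β)] [Fintype α] [Fintype β]
    (s : β → ℝ) (hs : ∑ y, s y = 0) (T : α → ℝ) (q : α) (c : β) :
    (Fintype.card β : ℝ) * ∑ φ : α → β, (if φ q = c then ∑ r, s (φ r) * T r else 0) =
      Fintype.card (α → β) * (s c * T q) := by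
  have hr : ∀ r, (Fintype.card β : ℝ) * ∑ φ : α → β, (if φ q = c then s (φ r) * T r else 0) =
      if r = q then Fintype.card (α → β) * (s c * T q) else 0 := by
    intro r
    split_ifs with h
    · subst h
      rw [← card_mul_sum_ite_eq r c, mul_assoc, Finset.sum_mul]
      congr 1
      refine Finset.sum_congr rfl fun φ _ => ?_
      split_ifs with h
      · rw [h, one_mul]
      · simp
    · rw [← sum_sum_update r (fun φ : α → β => if φ q = c then s (φ r) * T r else 0)]
      refine Finset.sum_eq_zero fun φ _ => ?_
      simp only [update_self, update_of_ne (Ne.symm h)]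
      split_ifs
      · rw [← Finset.sum_mul, hs, zero_mul]
      · simp
  have : ∀ φ : α → β, (if φ q = c then ∑ r, s (φ r) * T r else 0) =
      ∑ r, if φ q = c then s (φ r) * T r else 0 := fun φ => by split_ifs <;> simp
  rw [Finset.sum_congr rfl fun φ _ => this φ, Finset.sum_comm, Finset.mul_sum,
    Finset.sum_congr rfl fun r _ => hr r]
  simp

theorem sum_sum_apply_mul_eq_zero {α β : Type*} [Fintype (α → β)] [Fintype α] [Fintype β]
    [Nonempty β] (s : β → ℝ) (hs : ∑ y, s y = 0) (T : α → ℝ) :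
    ∑ φ : α → β, ∑ r, s (φ r) * T r = 0 := by
  classical
  rw [Finset.sum_comm]
  refine Finset.sum_eq_zero fun r _ => ?_
  have hn : (Fintype.card β : ℝ) ≠ 0 := by simp
  refine mul_left_cancel₀ hn ?_
  rw [← sum_sum_update r (fun φ : α → β => s (φ r) * T r), mul_zero]
  refine Finset.sum_eq_zero fun φ _ => ?_
  simp only [update_self]
  rw [← Finset.sum_mul, hs, zero_mul]

theorem exists_ne_zero_sum_eq_zero (β : Type*) [Fintype β] [Nontrivial β] :
    ∃ q : β → ℝ, (∀ y, q y ≠ 0) ∧ ∑ y, q y = 0 := by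
  classical
  obtain ⟨c⟩ := (inferInstance : Nonempty β)
  have hn : (1 : ℝ) < Fintype.card β := by exact_mod_cast Fintype.one_lt_card
  refine ⟨fun y => 1 - if y = c then (Fintype.card β : ℝ) else 0, fun y => ?_, ?_⟩
  · dsimp only
    split_ifs <;> linarith
  · simp

end Averaging

namespace MDAG

namespace Gearing

/-! ### The forest structure of a gearing -/

section Graph

variable {V : Type*} {W : Type*} {G : MDAG V W} (g : G.Gearing)

theorem exists_mem_R_of_mem_B {b : V} {j : Fin g.k} (hb : b ∈ g.B j) :
    ∃ i, b ∈ g.R i := by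
  induction j using WellFoundedLT.induction with
  | ind j ih =>
    by_cases h : ∃ i, i < j ∧ b ∈ g.B i
    · obtain ⟨i, hi, hbi⟩ := h
      exact ih i hi hbi
    · refine ⟨j, hb, fun h' => h ?_⟩
      simpa using h'

theorem exists_mem_R (hG : G.SingleDistrict) (l : Fin g.k) (b : V) : ∃ i, b ∈ g.R i := by
  have hl : g.B l ∈ G.bidirected := g.range_eq ▸ Set.mem_range_self l
  obtain ⟨c, -, hc⟩ := (G.nontrivial_of_mem _ hl).exists_ne b
  rcases (hG b trivial c trivial).cases_head with h | ⟨d, ⟨-, -, B, hB, hb, -⟩, -⟩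
  · exact absurd h.symm hc
  · rw [← g.range_eq] at hB
    obtain ⟨j, rfl⟩ := hB
    exact g.exists_mem_R_of_mem_B hb

theorem le_of_mem_R_of_mem_B {b : V} {i j : Fin g.k} (hi : b ∈ g.R i) (hj : b ∈ g.B j) :
    i ≤ j := by
  by_contra h
  exact hi.2 (Set.mem_iUnion₂.2 ⟨j, not_le.1 h, hj⟩)

theorem rank_lt_of_mem_pi {b c : V} (h : c ∈ g.pi b) : g.rank b < g.rank c := by
  have := g.rank_decreasing h
  omega

theorem notMem_pi_self (b : V) : b ∉ g.pi b := fun h => (g.rank_lt_of_mem_pi h).false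

/-- If `C` is bidirected-connected and meets a remainder set earlier than `R i`, then every vertex
of `C ∩ R i` lies in `π(d)` for some `d ∈ C`. The gearing makes the edges into the vertices of a
forest, in which `i` hangs from the edge `s` of the running intersection property. If `C` met `B i`
only within `R i`, then no path inside `C` could leave the edges of the subtree below `i`. -/
theorem exists_mem_pi (C : Set V) (hC : G.BidirectedConnected C) {i l : Fin g.k} (hli : l < i)
    {u z : V} (hu : u ∈ C) (hui : u ∈ g.R i) (hz : z ∈ C) (hzl : z ∈ g.R l) :
    ∃ d ∈ C, u ∈ g.pi d := by
  by_contra hcon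
  have hBi : ∀ d ∈ C, d ∈ g.B i → d ∈ g.R i := by
    intro d hd hdi
    obtain ⟨j, hj⟩ := g.exists_mem_R_of_mem_B hdi
    rcases (g.le_of_mem_R_of_mem_B hj hdi).lt_or_eq with h | rfl
    · exact absurd ⟨d, hd, i, j, h, hj, hdi, hui⟩ hcon
    · exact hj
  -- for `j = 0` the set `B j` equals `R j`, and the value of `s` is irrelevant
  have hs : ∀ j : Fin g.k, ∃ s : Fin g.k,
      ∀ d ∈ g.B j, d ∉ g.R j → s < j ∧ d ∈ g.B s := by
    intro j
    by_cases hj : 0 < j.val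
    · obtain ⟨s, hsj, h⟩ := g.running j hj
      refine ⟨s, fun d hd hdR => ⟨hsj, ?_⟩⟩
      have : d ∈ g.B j ∩ ⋃ i : Fin g.k, ⋃ _ : i < j, g.B i :=
        ⟨hd, by_contra fun h' => hdR ⟨hd, h'⟩⟩
      rw [h] at this
      exact this.2
    · refine ⟨j, fun d hd hdR => absurd ⟨hd, fun h' => ?_⟩ hdR⟩
      obtain ⟨m, hm, -⟩ := Set.mem_iUnion₂.1 h'
      have : m.val < j.val := hm
      omega
  choose s hs using hs
  -- `Below j` says that the edge `B j` lies in the subtree rooted at `B i`.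
  let Below : Fin g.k → Prop := fun j =>
    Relation.ReflTransGen (fun a b : Fin g.k => b < a ∧ s a = b) j i
  have hle : ∀ j, Below j → i ≤ j := by
    intro j hj
    induction hj using Relation.ReflTransGen.head_induction_on with
    | refl => exact le_rfl
    | head h _ ih => exact ih.trans h.1.le
  -- every edge through a vertex whose first edge lies in the subtree lies in the subtree
  have hup : ∀ j m d, d ∈ g.B j → d ∈ g.R m → Below m → Below j := by
    intro j
    induction j using WellFoundedLT.induction with
    | ind j ih =>
      intro m d hd hm hb
      by_cases hdj : d ∈ g.R j
      · rwa [g.R_unique hdj hm]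
      · obtain ⟨h1, h2⟩ := hs j d hd hdj
        exact Relation.ReflTransGen.head ⟨h1, rfl⟩ (ih _ h1 m d h2 hm hb)
  -- an edge of the subtree can be left only through a vertex of `B i` outside `R i`, and `hBi`
  -- excludes these from `C`
  have hdown : ∀ j, ∀ d ∈ C, d ∈ g.B j → Below j → ∃ m, d ∈ g.R m ∧ Below m := by
    intro j
    induction j using WellFoundedLT.induction with
    | ind j ih =>
      intro d hdC hd hb
      by_cases hdj : d ∈ g.R j
      · exact ⟨j, hdj, hb⟩
      · rcases hb.cases_head with rfl | ⟨c, ⟨hc, rfl⟩, hbc⟩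
        · exact absurd (hBi d hdC hd) hdj
        · exact ih _ hc d hdC (hs j d hd hdj).2 hbc
  have hpath : ∀ c, Relation.ReflTransGen
      (fun c d : V => c ∈ C ∧ d ∈ C ∧ ∃ B ∈ G.bidirected, c ∈ B ∧ d ∈ B) u c →
      ∃ m, c ∈ g.R m ∧ Below m := by
    intro c hc
    induction hc with
    | refl => exact ⟨i, hui, .refl⟩
    | tail _ hstep ih =>
      obtain ⟨m, hm, hbm⟩ := ih
      obtain ⟨-, hd, B, hB, hcB, hdB⟩ := hstep
      rw [← g.range_eq] at hB
      obtain ⟨j, rfl⟩ := hB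
      exact hdown j _ hd hdB (hup j m _ hcB hm hbm)
  obtain ⟨m, hm, hbm⟩ := hpath z (hC u hu z hz)
  rw [g.R_unique hm hzl] at hbm
  exact absurd (hle l hbm) (not_le.2 hli)

end Graph

/-! ### Nested weights and summing out vertices -/

section Agreement

variable {V : Type*} {W : Type*} {G : MDAG V W} (g : G.Gearing) (X : V ⊕ W → Type*)

/-- `f_b` takes the value `x_b` when its arguments are read off `x` and the other components
of `f`. -/
def Agrees (f : ∀ b : V, g.Fn X b) (x : ∀ a, X a) (b : V) : Prop :=
  g.fnEquiv X b (f b) (fun a => x a.1, fun c => f c.1) = x (Sum.inl b)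

theorem forall_mem_Phi_iff (hR : ∀ b, ∃ i, b ∈ g.R i) (f : ∀ b : V, g.Fn X b) (x : ∀ a, X a) :
    (∀ i, (fun b : g.R i => f b.1) ∈ g.Phi X i (fun c => f c.1) x) ↔
      ∀ b, g.Agrees X f x b := by
  constructor
  · intro h b
    obtain ⟨i, hi⟩ := hR b
    exact h i ⟨b, hi⟩
  · intro h i b
    exact h b.1

end Agreement

section Weight

variable {V : Type*} {W : Type*} {G : MDAG V W} (g : G.Gearing) [Fintype V] [Fintype W]
  (X : V ⊕ W → Type*) [∀ a, Fintype (X a)]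

open Classical in
/-- The weight `e_b` on `F_b`, a sum over all arguments of `φ`: the factor at the argument `(y, h)`
is `s_b(φ(y, h)) t_b(y)` times the weights `e_c(h_c)` of the vertices `c` owned by `b`, i.e. those
with `o c = some b`. -/
noncomputable def weight (s : ∀ b : V, X (Sum.inl b) → ℝ)
    (t : ∀ b : V, (∀ a : G.pa b, X a.1) → ℝ) (o : V → Option V) (b : V) (φ : g.Fn X b) : ℝ :=
  ∑ q : (∀ a : G.pa b, X a.1) × (∀ c : g.pi b, g.Fn X c.1),
    s b (g.fnEquiv X b φ q) *
      (t b q.1 * ∏ c : g.pi b, if o c.1 = some b then weight s t o c.1 (q.2 c) else 1)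
termination_by g.k - g.rank b
decreasing_by exact g.rank_decreasing c.2

variable (s : ∀ b : V, X (Sum.inl b) → ℝ) (t : ∀ b : V, (∀ a : G.pa b, X a.1) → ℝ)
  (o : V → Option V)

open Classical in
theorem weight_eq (b : V) : g.weight X s t o b = fun φ =>
    ∑ q : (∀ a : G.pa b, X a.1) × (∀ c : g.pi b, g.Fn X c.1),
      s b (g.fnEquiv X b φ q) *
        (t b q.1 * ∏ c : g.pi b, if o c.1 = some b then g.weight X s t o c.1 (q.2 c) else 1) :=
  funext fun φ => by rw [weight]

theorem sum_weight [∀ a, Nonempty (X a)] {b : V} (hs : ∑ y, s b y = 0) :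
    ∑ φ, g.weight X s t o b φ = 0 := by
  classical
  rw [weight_eq]
  rw [Equiv.sum_comp (g.fnEquiv X b) (fun ψ => ∑ q, s b (ψ q) *
      (t b q.1 * ∏ c : g.pi b, if o c.1 = some b then g.weight X s t o c.1 (q.2 c) else 1))]
  exact sum_sum_apply_mul_eq_zero (s b) hs _

open Classical in
theorem card_mul_sum_ite_one (b : V)
    (q : (∀ a : G.pa b, X a.1) × (∀ c : g.pi b, g.Fn X c.1)) (c : X (Sum.inl b)) :
    (Fintype.card (X (Sum.inl b)) : ℝ) *
      ∑ φ, (if g.fnEquiv X b φ q = c then (1 : ℝ) else 0) = Fintype.card (g.Fn X b) := by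
  rw [Equiv.sum_comp (g.fnEquiv X b) (fun ψ => if ψ q = c then (1 : ℝ) else 0),
    card_mul_sum_ite_eq, Fintype.card_congr (g.fnEquiv X b)]

open Classical in
theorem card_mul_sum_ite_weight {b : V} (hs : ∑ y, s b y = 0)
    (q : (∀ a : G.pa b, X a.1) × (∀ c : g.pi b, g.Fn X c.1)) (c : X (Sum.inl b)) :
    (Fintype.card (X (Sum.inl b)) : ℝ) *
      ∑ φ, (if g.fnEquiv X b φ q = c then g.weight X s t o b φ else 0) =
    Fintype.card (g.Fn X b) * (s b c * (t b q.1 *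
      ∏ d : g.pi b, if o d.1 = some b then g.weight X s t o d.1 (q.2 d) else 1)) := by
  rw [weight_eq]
  rw [Equiv.sum_comp (g.fnEquiv X b) (fun ψ => if ψ q = c then ∑ q, s b (ψ q) *
      (t b q.1 * ∏ c : g.pi b, if o c.1 = some b then g.weight X s t o c.1 (q.2 c) else 1) else 0),
    card_mul_sum_ite_mul_sum (s b) hs, Fintype.card_congr (g.fnEquiv X b)]

open Classical in
/-- Vertices of an up-closed set `Q` are summed out in increasing order of rank. When the turn of
`b` comes, `f_b` occurs only in the constraint at `b` and in the weight `e_b`; summing it out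
replaces them by `s_b(x_b) t_b(x_{pa(b)})` and releases the weights of the vertices owned
by `b`. -/
theorem sum_prod_agrees_mul_prod_weight [∀ a, Nonempty (X a)] (C : Set V)
    (hs : ∀ b ∈ C, ∑ y, s b y = 0)
    (ho : ∀ c d, o c = some d → c ∈ C ∧ d ∈ C ∧ c ∈ g.pi d) (x : ∀ a, X a) (Q : Finset V)
    (hQ : ∀ b ∈ Q, ∀ c ∈ g.pi b, c ∈ Q) :
    ∑ f : (∀ b : V, g.Fn X b), (∏ b ∈ Q, if g.Agrees X f x b then (1 : ℝ) else 0) *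
      ∏ c ∈ Q, (if c ∈ C ∧ ∀ d, o c = some d → d ∉ Q then g.weight X s t o c (f c) else 1) =
    Fintype.card (∀ b : V, g.Fn X b) *
      ∏ b ∈ Q, (if b ∈ C then s b (x (Sum.inl b)) * t b (fun a => x a.1) else 1) /
        Fintype.card (X (Sum.inl b)) := by
  induction Q using Finset.induction_on_min_value g.rank with
  | empty => simp
  | insert v Q hv hmin ih =>
    have hself : ∀ b ∈ Q, v ∉ g.pi b := fun b hb hvb =>
      absurd (g.rank_lt_of_mem_pi hvb) (not_lt.2 (hmin b hb))
    have hQ' : ∀ b ∈ Q, ∀ c ∈ g.pi b, c ∈ Q := fun b hb c hc =>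
      Finset.mem_of_mem_insert_of_ne (hQ b (Finset.mem_insert_of_mem hb) c hc)
        (ne_of_mem_of_not_mem hc (hself b hb))
    have hpiv : ∀ c ∈ g.pi v, c ∈ Q := fun c hc =>
      Finset.mem_of_mem_insert_of_ne (hQ v (Finset.mem_insert_self _ _) c hc)
        (ne_of_mem_of_not_mem hc (g.notMem_pi_self v))
    specialize ih hQ'
    have hX : (Fintype.card (X (Sum.inl v)) : ℝ) ≠ 0 := by simp
    have hF : (Fintype.card (g.Fn X v) : ℝ) ≠ 0 := by
      have : Nonempty (g.Fn X v) := (g.fnEquiv X v).nonempty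
      simp
    refine mul_left_cancel₀ hF (mul_left_cancel₀ hX ?_)
    rw [← sum_sum_update v, Finset.prod_insert hv, mul_left_comm (Fintype.card (∀ b, g.Fn X b) : ℝ),
      ← ih, Finset.mul_sum]
    conv_rhs => rw [Finset.mul_sum, Finset.mul_sum, Finset.mul_sum]
    refine Finset.sum_congr rfl fun f _ => ?_
    have hroot : ∀ d, o v = some d → d ∉ insert v Q := by
      intro d hd hmem
      have hvd := (ho v d hd).2.2
      rcases Finset.mem_insert.1 hmem with rfl | h
      · exact g.notMem_pi_self _ hvd
      · exact hself d h hvd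
    have hA : ∀ φ, ∀ b ∈ Q, g.Agrees X (update f v φ) x b ↔ g.Agrees X f x b := by
      intro φ b hb
      have h2 : (fun c : g.pi b => update f v φ c.1) = fun c : g.pi b => f c.1 :=
        funext fun c => update_of_ne (ne_of_mem_of_not_mem c.2 (hself b hb)) _ _
      rw [Agrees, Agrees, h2, update_of_ne (ne_of_mem_of_not_mem hb hv)]
    have hAv : ∀ φ, g.Agrees X (update f v φ) x v ↔
        g.fnEquiv X v φ (fun a => x a.1, fun c => f c.1) = x (Sum.inl v) := by
      intro φ
      have h2 : (fun c : g.pi v => update f v φ c.1) = fun c : g.pi v => f c.1 :=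
        funext fun c => update_of_ne (ne_of_mem_of_not_mem c.2 (g.notMem_pi_self v)) _ _
      rw [Agrees, h2, update_self]
    -- the factors that do not involve `f_v`
    set K : ℝ := (∏ b ∈ Q, if g.Agrees X f x b then (1 : ℝ) else 0) *
      ∏ c ∈ Q, (if c ∈ C ∧ ∀ d, o c = some d → d ∉ insert v Q then g.weight X s t o c (f c)
        else 1) with hK
    have hL : ∀ φ, (∏ b ∈ insert v Q, if g.Agrees X (update f v φ) x b then (1 : ℝ) else 0) *
        ∏ c ∈ insert v Q, (if c ∈ C ∧ ∀ d, o c = some d → d ∉ insert v Q then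
          g.weight X s t o c (update f v φ c) else 1) =
        K * (if g.fnEquiv X v φ (fun a => x a.1, fun c => f c.1) = x (Sum.inl v) then
          (if v ∈ C then g.weight X s t o v φ else 1) else 0) := by
      intro φ
      rw [Finset.prod_insert hv, Finset.prod_insert hv, hK]
      have e1 : ∏ b ∈ Q, (if g.Agrees X (update f v φ) x b then (1 : ℝ) else 0) =
          ∏ b ∈ Q, if g.Agrees X f x b then (1 : ℝ) else 0 :=
        Finset.prod_congr rfl fun b hb => by simp only [hA φ b hb]
      have e2 : ∏ c ∈ Q, (if c ∈ C ∧ ∀ d, o c = some d → d ∉ insert v Q then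
          g.weight X s t o c (update f v φ c) else 1) =
          ∏ c ∈ Q, (if c ∈ C ∧ ∀ d, o c = some d → d ∉ insert v Q then
            g.weight X s t o c (f c) else 1) :=
        Finset.prod_congr rfl fun b hb => by rw [update_of_ne (ne_of_mem_of_not_mem hb hv)]
      rw [e1, e2]
      simp only [hAv, update_self, and_iff_left hroot]
      split_ifs <;> ring
    rw [Finset.sum_congr rfl fun φ _ => hL φ, ← Finset.mul_sum]
    by_cases hvC : v ∈ C
    · -- the weights released by `v`
      have hrel : ∏ c ∈ Q, (if c ∈ C ∧ ∀ d, o c = some d → d ∉ Q then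
          g.weight X s t o c (f c) else 1) =
          (∏ c ∈ Q, (if c ∈ C ∧ ∀ d, o c = some d → d ∉ insert v Q then
            g.weight X s t o c (f c) else 1)) *
          ∏ c : g.pi v, if o c.1 = some v then g.weight X s t o c.1 (f c.1) else 1 := by
        have e3 : (∏ c : g.pi v, if o c.1 = some v then g.weight X s t o c.1 (f c.1) else 1) =
            ∏ c ∈ Q, if o c = some v then g.weight X s t o c (f c) else 1 := by
          rw [← Finset.prod_subtype (g.pi v).toFinset (fun c => Set.mem_toFinset)
            (fun c => if o c = some v then g.weight X s t o c (f c) else 1)]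
          refine Finset.prod_subset (fun c hc => hpiv c (Set.mem_toFinset.1 hc)) fun c _ hc => ?_
          rw [if_neg fun h => hc (Set.mem_toFinset.2 (ho c v h).2.2)]
        rw [e3, ← Finset.prod_mul_distrib]
        refine Finset.prod_congr rfl fun c _ => ?_
        by_cases hc : o c = some v
        · have := (ho c v hc).1
          simp [hc, this, hv]
        · have : (∀ d, o c = some d → d ∉ insert v Q) ↔ ∀ d, o c = some d → d ∉ Q := by
            refine forall₂_congr fun d hd => ?_
            have : d ≠ v := by rintro rfl; exact hc hd
            simp [this]
          simp only [this, hc, if_false, mul_one]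
      have := g.card_mul_sum_ite_weight X s t o (hs v hvC)
        (fun a => x a.1, fun c => f c.1) (x (Sum.inl v))
      simp only [hvC, if_true]
      rw [mul_left_comm, this, hrel, hK]
      field_simp
    · have hrel : ∏ c ∈ Q, (if c ∈ C ∧ ∀ d, o c = some d → d ∉ Q then
          g.weight X s t o c (f c) else 1) =
          (∏ c ∈ Q, (if c ∈ C ∧ ∀ d, o c = some d → d ∉ insert v Q then
            g.weight X s t o c (f c) else 1)) := by
        refine Finset.prod_congr rfl fun c _ => ?_
        have : (∀ d, o c = some d → d ∉ insert v Q) ↔ ∀ d, o c = some d → d ∉ Q := by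
          refine forall₂_congr fun d hd => ?_
          have : d ≠ v := by rintro rfl; exact hvC (ho c d hd).2.1
          simp [this]
        simp only [this]
      have := g.card_mul_sum_ite_one X v (fun a => x a.1, fun c => f c.1) (x (Sum.inl v))
      simp only [hvC, if_false]
      rw [mul_left_comm, this, hrel, hK]
      field_simp

end Weight

end Gearing


/-! ### The symmetric difference of the sets `A i` -/
theorem sterile_subset_bigSymmDiff {V W : Type*} {G : MDAG V W} (g : G.Gearing)
    (hR : ∀ b, ∃ i, b ∈ g.R i) (C : Set V) (A : Fin g.k → Set (V ⊕ W))
    (hA : ∀ i ∈ {i | (C ∩ g.R i).Nonempty}, G.sterile (C ∩ g.R i) ⊆ A i ∧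
      A i ⊆ Sum.inl '' (C ∩ g.R i) ∪ G.paSet (C ∩ g.R i)) :
    G.sterile C ⊆ bigSymmDiff {i | (C ∩ g.R i).Nonempty} A := by
  classical
  rintro _ ⟨⟨b, hb, rfl⟩, hpa⟩
  obtain ⟨i, hi⟩ := hR b
  have hpa' : ∀ j, Sum.inl b ∉ G.paSet (C ∩ g.R j) := fun j h => hpa <| by
    obtain ⟨c, hc, hbc⟩ := Set.mem_iUnion₂.1 h
    exact Set.mem_iUnion₂.2 ⟨c, hc.1, hbc⟩
  have h1 : Finset.univ.filter (fun j => j ∈ {i | (C ∩ g.R i).Nonempty} ∧ Sum.inl b ∈ A j) =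
      {i} := by
    ext j
    simp only [Finset.mem_filter, Finset.mem_univ, true_and, Finset.mem_singleton]
    constructor
    · rintro ⟨hj, hbj⟩
      rcases (hA j hj).2 hbj with ⟨c, hc, hcb⟩ | h
      · obtain rfl := Sum.inl_injective hcb
        exact g.R_unique hc.2 hi
      · exact absurd h (hpa' j)
    · rintro rfl
      have : (C ∩ g.R j).Nonempty := ⟨b, hb, hi⟩
      exact ⟨this, (hA j this).1 ⟨⟨b, ⟨hb, hi⟩, rfl⟩, hpa' j⟩⟩
  have h2 : Odd (Finset.univ.filter
      (fun j => j ∈ {i | (C ∩ g.R i).Nonempty} ∧ Sum.inl b ∈ A j)).card := by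
    rw [h1]
    simp
  change Odd _
  convert h2

open Classical in
theorem bigSymmDiff_subset {V W : Type*} {G : MDAG V W} (g : G.Gearing)
    (C : Set V) (A : Fin g.k → Set (V ⊕ W)) (I : Set (Fin g.k))
    (hA : ∀ i ∈ I, A i ⊆ Sum.inl '' (C ∩ g.R i) ∪ G.paSet (C ∩ g.R i)) :
    bigSymmDiff I A ⊆ Sum.inl '' C ∪ G.paSet C := by
  intro a ha
  obtain ⟨i, hi⟩ := Finset.card_pos.1 (Odd.pos ha)
  obtain ⟨-, hi, hai⟩ := Finset.mem_filter.1 hi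
  rcases hA i hi hai with ⟨c, hc, rfl⟩ | h
  · exact Or.inl ⟨c, hc.1, rfl⟩
  · obtain ⟨c, hc, hac⟩ := Set.mem_iUnion₂.1 h
    exact Or.inr (Set.mem_iUnion₂.2 ⟨c, hc.1, hac⟩)

namespace Gearing

/-! ### The directions `D_l` -/

section Direction

variable {V : Type*} {W : Type*} {G : MDAG V W} (g : G.Gearing) [Fintype V] [Fintype W]
  (X : V ⊕ W → Type*) [∀ a, Fintype (X a)]

open Classical in
theorem P_eq_sum_prod (hR : ∀ b, ∃ i, b ∈ g.R i) (ρ : g.Weights X) (x : ∀ a, X a) :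
    g.P X ρ x = ∑ f : (∀ b : V, g.Fn X b), (∏ b, if g.Agrees X f x b then (1 : ℝ) else 0) *
      ∏ i, ρ i (fun b => f b.1) := by
  rw [P, Finset.sum_filter]
  refine Finset.sum_congr rfl fun f _ => ?_
  simp only [g.forall_mem_Phi_iff X hR, Finset.prod_boole, Finset.mem_univ, forall_true_left]
  split_ifs <;> simp

open Classical in
/-- `P` is affine in each single weight, so the difference quotients are constant. -/
theorem isDirection_sum_prod (hR : ∀ b, ∃ i, b ∈ g.R i) (i : Fin g.k)
    (ε : g.FnSet X (g.R i) → ℝ) :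
    g.IsDirection X i ε fun x => ∑ f : (∀ b : V, g.Fn X b),
      (∏ b, if g.Agrees X f x b then (1 : ℝ) else 0) * ε fun b => f b.1 := by
  refine tendsto_const_nhds.congr' ?_
  filter_upwards [self_mem_nhdsWithin] with η hη
  have hη : η ≠ 0 := ne_of_gt hη
  funext x
  have hρ : ∀ f : (∀ b : V, g.Fn X b),
      ∏ j, update (1 : g.Weights X) i (1 + η • ε) j (fun b => f b.1) =
        1 + η * ε fun b => f b.1 := by
    intro f
    rw [Fintype.prod_eq_single i fun j hj => by simp [update_of_ne hj]]
    simp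
  simp only [Pi.smul_apply, Pi.sub_apply, g.P_eq_sum_prod X hR, hρ, smul_eq_mul]
  rw [← Finset.sum_sub_distrib, Finset.mul_sum]
  refine Finset.sum_congr rfl fun f _ => ?_
  simp only [Pi.one_apply, Finset.prod_const_one]
  field_simp
  ring

open Classical in
/-- The product of the weights `e_c` over `C ∩ R_l`, as a function of the variable `f_{R_l}`. -/
noncomputable def rootWeight (C : Set V) (l : Fin g.k) (s : ∀ b : V, X (Sum.inl b) → ℝ)
    (t : ∀ b : V, (∀ a : G.pa b, X a.1) → ℝ) (o : V → Option V)
    (f : g.FnSet X (g.R l)) : ℝ :=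
  ∏ c : g.R l, if c.1 ∈ C then g.weight X s t o c.1 (f c) else 1

variable (s : ∀ b : V, X (Sum.inl b) → ℝ) (t : ∀ b : V, (∀ a : G.pa b, X a.1) → ℝ)
  (o : V → Option V) (C : Set V) (l : Fin g.k)

theorem sum_rootWeight [∀ a, Nonempty (X a)] (hl : (C ∩ g.R l).Nonempty)
    (hs : ∀ b ∈ C, ∑ y, s b y = 0) : ∑ f, g.rootWeight X C l s t o f = 0 := by
  classical
  obtain ⟨b, hbC, hbl⟩ := hl
  have h : ∏ c : g.R l, ∑ φ, (if c.1 ∈ C then g.weight X s t o c.1 φ else 1) = 0 := by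
    refine Finset.prod_eq_zero (Finset.mem_univ ⟨b, hbl⟩) ?_
    simp only [hbC, if_true]
    exact g.sum_weight X s t o (hs b hbC)
  rw [Fintype.prod_sum] at h
  unfold rootWeight
  convert h

open Classical in
theorem sum_prod_agrees_mul_rootWeight [∀ a, Nonempty (X a)] (hs : ∀ b ∈ C, ∑ y, s b y = 0)
    (ho : ∀ c d, o c = some d → c ∈ C ∧ d ∈ C ∧ c ∈ g.pi d)
    (hl : ∀ c ∈ C, c ∈ g.R l ↔ o c = none) (x : ∀ a, X a) :
    ∑ f : (∀ b : V, g.Fn X b), (∏ b, if g.Agrees X f x b then (1 : ℝ) else 0) *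
      g.rootWeight X C l s t o (fun b => f b.1) =
    (Fintype.card (∀ b : V, g.Fn X b) / ∏ b, (Fintype.card (X (Sum.inl b)) : ℝ)) *
      ∏ b, if b ∈ C then s b (x (Sum.inl b)) * t b (fun a => x a.1) else 1 := by
  have := g.sum_prod_agrees_mul_prod_weight X s t o C hs ho x Finset.univ fun _ _ _ _ =>
    Finset.mem_univ _
  rw [div_mul_eq_mul_div, mul_div_assoc, ← Finset.prod_div_distrib, ← this]
  refine Finset.sum_congr rfl fun f _ => ?_
  congr 1
  rw [rootWeight, ← Finset.prod_subtype (g.R l).toFinset (fun c => Set.mem_toFinset)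
    (fun c => if c ∈ C then g.weight X s t o c (f c) else 1)]
  refine Finset.prod_subset_one_on_sdiff (Finset.subset_univ _) (fun c hc => ?_) fun c hc => ?_
  · rw [if_neg]
    rintro ⟨hcC, h⟩
    have hcl : c ∉ g.R l := fun h => (Finset.mem_sdiff.1 hc).2 (Set.mem_toFinset.2 h)
    rw [hl c hcC, Option.eq_none_iff_forall_ne_some] at hcl
    push Not at hcl
    obtain ⟨d, hd⟩ := hcl
    exact h d hd (Finset.mem_univ d)
  · have hcl := Set.mem_toFinset.1 hc
    by_cases hcC : c ∈ C
    · simp [hcC, (hl c hcC).1 hcl]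
    · simp [hcC]

end Direction

/-! ### Reproducing the vectors of `Λ_A` -/

open Classical in
/-- Distributing over the vertices of `C` a factor for each parent, by choosing for each parent one
of its children in `C`. -/
theorem prod_prod_child {V W : Type*} [Fintype V] [Fintype W] {G : MDAG V W} (C : Set V)
    (ch : V ⊕ W → V) (hch : ∀ a ∈ G.paSet C, ch a ∈ C ∧ a ∈ G.pa (ch a)) (τ : V ⊕ W → ℝ) :
    ∏ b, (if b ∈ C then ∏ a, if a ∈ G.pa b ∧ ch a = b then τ a else 1 else 1) =
      ∏ a, if a ∈ G.paSet C then τ a else 1 := by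
  have : ∀ b, (if b ∈ C then ∏ a, if a ∈ G.pa b ∧ ch a = b then τ a else 1 else 1) =
      ∏ a, if ch a = b then (if a ∈ G.paSet C then τ a else 1) else 1 := by
    intro b
    split_ifs with hb
    · refine Finset.prod_congr rfl fun a _ => ?_
      by_cases h : ch a = b
      · subst h
        have : a ∈ G.pa (ch a) ↔ a ∈ G.paSet C :=
          ⟨fun h => Set.mem_iUnion₂.2 ⟨_, hb, h⟩, fun h => (hch a h).2⟩
        simp [this]
      · simp [h]
    · symm
      refine Finset.prod_eq_one fun a _ => ?_
      split_ifs with h h'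
      · exact absurd (h ▸ (hch a h').1) hb
      · rfl
      · rfl
  rw [Finset.prod_congr rfl fun b _ => this b, Finset.prod_comm]
  simp

/-- `T_l` already contains `Λ_A` whenever `A` lies between `sterile(C)` and `C ∪ pa(C)`. -/
theorem Lam_subset_T {V W : Type*} [Fintype V] [Fintype W] {G : MDAG V W} (g : G.Gearing)
    (hR : ∀ b, ∃ i, b ∈ g.R i) (X : V ⊕ W → Type*) [∀ a, Fintype (X a)] [∀ a, Nontrivial (X a)]
    (C : Set V) (hC : G.BidirectedConnected C) (A : Set (V ⊕ W)) (hSA : G.sterile C ⊆ A)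
    (hAC : A ⊆ Sum.inl '' C ∪ G.paSet C) (l : Fin g.k) (hl : (C ∩ g.R l).Nonempty)
    (hmin : ∀ i, (C ∩ g.R i).Nonempty → l ≤ i) :
    (Lam X A : Set ((∀ a, X a) → ℝ)) ⊆ g.T X l := by
  classical
  intro p hp
  obtain ⟨hp0', hpA⟩ := hp
  have hp0 : ∀ a ∈ A, ∀ x : ∀ a, X a, ∑ y : X a, p (update x a y) = 0 := fun a ha x => by
    convert hp0' a ha x
  have hl' := hl
  obtain ⟨v₀, hv₀C, hv₀l⟩ := hl'
  -- each vertex of `C` outside `R l` has an owner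
  have howner : ∀ u, ∃ o : Option V, (∀ d, o = some d → u ∈ C ∧ d ∈ C ∧ u ∈ g.pi d) ∧
      (u ∈ C → (u ∈ g.R l ↔ o = none)) := by
    intro u
    by_cases hu : u ∈ C ∧ u ∉ g.R l
    · obtain ⟨i, hi⟩ := hR u
      have hli : l < i := (hmin i ⟨u, hu.1, hi⟩).lt_of_ne (by rintro rfl; exact hu.2 hi)
      obtain ⟨d, hd, hud⟩ := g.exists_mem_pi C hC hli hu.1 hi hv₀C hv₀l
      refine ⟨some d, fun d' hd' => ?_, fun _ => by simp [hu.2]⟩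
      obtain rfl := Option.some_injective _ hd'
      exact ⟨hu.1, hd, hud⟩
    · exact ⟨none, by simp, fun huC => by simpa [huC] using hu⟩
  choose o ho hroot using howner
  have hchild : ∀ a, ∃ b, a ∈ G.paSet C → b ∈ C ∧ a ∈ G.pa b := by
    intro a
    by_cases ha : a ∈ G.paSet C
    · obtain ⟨b, hb, hab⟩ := Set.mem_iUnion₂.1 ha
      exact ⟨b, fun _ => ⟨hb, hab⟩⟩
    · exact ⟨v₀, fun h => absurd h ha⟩
  choose ch hch using hchild
  choose q hq0 hq using fun a => exists_ne_zero_sum_eq_zero (X a)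
  have hX : ∀ a, (Fintype.card (X a) : ℝ) ≠ 0 := fun a => by simp
  -- a sterile vertex of `C` carries a centred point mass, and any other vertex of `C` a nowhere
  -- vanishing function with sum zero, which its chosen child divides out again
  let s : (∀ a, X a) → ∀ b : V, X (Sum.inl b) → ℝ := fun z b y =>
    if Sum.inl b ∈ G.paSet C then q _ y
    else (if y = z (Sum.inl b) then 1 else 0) - 1 / Fintype.card (X (Sum.inl b))
  let τ : (∀ a, X a) → ∀ a, X a → ℝ := fun z a y =>
    (if y = z a then 1 else 0) / if a ∈ Sum.inl '' C then q a y else 1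
  let t : (∀ a, X a) → ∀ b : V, (∀ a : G.pa b, X a.1) → ℝ := fun z b y =>
    ∏ a, if h : a ∈ G.pa b ∧ ch a = b then τ z a (y ⟨a, h.1⟩) else 1
  -- the resulting kernel: `M * p x` is its sum against `p`
  let κ : ∀ a, X a → X a → ℝ := fun a y w =>
    if a ∈ G.paSet C then (if y = w then 1 else 0)
    else if a ∈ Sum.inl '' C then (if y = w then 1 else 0) - 1 / Fintype.card (X a) else 1
  let m : V ⊕ W → ℝ := fun a => if a ∈ Sum.inl '' C ∪ G.paSet C then 1 else Fintype.card (X a)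
  have hs : ∀ z, ∀ b ∈ C, ∑ y, s z b y = 0 := by
    intro z b _
    simp only [s]
    split_ifs
    · exact hq _
    · simp [Finset.sum_sub_distrib]
  have hprod : ∀ z x : ∀ a, X a,
      ∏ b, (if b ∈ C then s z b (x (Sum.inl b)) * t z b (fun a => x a.1) else 1) =
        ∏ a, κ a (x a) (z a) := by
    intro z x
    have h1 : ∏ b, (if b ∈ C then t z b (fun a => x a.1) else 1) =
        ∏ a, if a ∈ G.paSet C then τ z a (x a) else 1 := by
      rw [← prod_prod_child C ch hch]
      simp only [t, dite_eq_ite]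
    have h2 : ∏ b, (if b ∈ C then s z b (x (Sum.inl b)) else 1) =
        ∏ a, if a ∈ Sum.inl '' C then (if a ∈ G.paSet C then q a (x a)
          else (if x a = z a then 1 else 0) - 1 / (Fintype.card (X a) : ℝ)) else 1 := by
      rw [Fintype.prod_sum_type]
      simp [s]
    have h3 : ∀ b, (if b ∈ C then s z b (x (Sum.inl b)) * t z b (fun a => x a.1) else 1) =
        (if b ∈ C then s z b (x (Sum.inl b)) else 1) *
          if b ∈ C then t z b (fun a => x a.1) else 1 := fun b => by split_ifs <;> simp
    rw [Finset.prod_congr rfl fun b _ => h3 b, Finset.prod_mul_distrib, h1, h2,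
      ← Finset.prod_mul_distrib]
    refine Finset.prod_congr rfl fun a _ => ?_
    simp only [τ, κ]
    by_cases h : a ∈ G.paSet C <;> by_cases h' : a ∈ Sum.inl '' C <;>
      simp only [h, h', if_true, if_false, one_mul, mul_one, div_one]
    rw [mul_div_cancel₀ _ (hq0 a (x a))]
  have hκ : ∀ a x, ∑ y, κ a (x a) y * p (update x a y) = m a * p x := by
    intro a x
    simp only [κ, m]
    by_cases h : a ∈ G.paSet C
    · simp [h]
    · by_cases h' : a ∈ Sum.inl '' C
      · have := hp0 a (hSA ⟨h', h⟩) x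
        have hu : a ∈ Sum.inl '' C ∪ G.paSet C := Or.inl h'
        simp only [h, h', hu, if_true, if_false, sub_mul, Finset.sum_sub_distrib,
          ← Finset.mul_sum]
        rw [this]
        simp
      · have hu : a ∉ Sum.inl '' C ∪ G.paSet C := fun hu => hu.elim h' h
        have haA : a ∉ A := fun ha => hu (hAC ha)
        have : ∀ y, p (update x a y) = p x := fun y => hpA _ _ fun b hb =>
          update_of_ne (ne_of_mem_of_not_mem hb haA) _ _
        simp only [h, h', hu, if_false, this]
        simp
  have hker := sum_prod_kernel_mul κ m p hκ
  have hM : ∏ a, m a ≠ 0 := by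
    refine Finset.prod_ne_zero_iff.2 fun a _ => ?_
    simp only [m]
    split_ifs
    · exact one_ne_zero
    · exact hX a
  set M := ∏ a, m a
  set c : ℝ := Fintype.card (∀ b : V, g.Fn X b) / ∏ b, (Fintype.card (X (Sum.inl b)) : ℝ) with hc
  have hc0 : c ≠ 0 := by
    have : ∀ b, Nonempty (g.Fn X b) := fun b => (g.fnEquiv X b).nonempty
    exact div_ne_zero (Nat.cast_ne_zero.2 Fintype.card_ne_zero)
      (Finset.prod_ne_zero_iff.2 fun b _ => hX _)
  let ε : g.FnSet X (g.R l) → ℝ := fun f =>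
    ∑ z, p z / (M * c) * g.rootWeight X C l (s z) (t z) o f
  refine ⟨ε, ?_, ?_⟩
  · simp only [Degenerate, ε]
    rw [Finset.sum_comm]
    refine Finset.sum_eq_zero fun z _ => ?_
    rw [← Finset.mul_sum, g.sum_rootWeight X (s z) (t z) o C l hl (hs z), mul_zero]
  · convert g.isDirection_sum_prod X hR l ε using 1
    funext x
    simp only [ε, Finset.mul_sum]
    rw [Finset.sum_comm]
    have : ∀ z, ∑ f : (∀ b : V, g.Fn X b), (∏ b, if g.Agrees X f x b then (1 : ℝ) else 0) *
        (p z / (M * c) * g.rootWeight X C l (s z) (t z) o fun b => f b.1) =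
        M⁻¹ * ((∏ a, κ a (x a) (z a)) * p z) := by
      intro z
      simp only [mul_left_comm _ (p z / (M * c))]
      rw [← Finset.mul_sum, g.sum_prod_agrees_mul_rootWeight X (s z) (t z) o C l (hs z) ho hroot x,
        hprod, ← hc]
      field_simp
    rw [Finset.sum_congr rfl fun z _ => this z, ← Finset.mul_sum, hker]
    field_simp

end Gearing

end MDAG

theorem lemma5p5 {V W : Type*} [Fintype V] [Fintype W] (G : MDAG V W)
    (hG : G.SingleDistrict) (g : G.Gearing)
    (X : V ⊕ W → Type*) [∀ a, Fintype (X a)] [∀ a, Nontrivial (X a)]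
    (C : Set V) (hC : G.BidirectedConnected C)
    (I : Set (Fin g.k)) (hI : I = {i | (C ∩ g.R i).Nonempty})
    (A : Fin g.k → Set (V ⊕ W))
    (hA : ∀ i ∈ I, G.sterile (C ∩ g.R i) ⊆ A i ∧
      A i ⊆ Sum.inl '' (C ∩ g.R i) ∪ G.paSet (C ∩ g.R i))
    (l : Fin g.k) (hl : IsLeast I l) :
    (Lam X (bigSymmDiff I A) : Set ((∀ a, X a) → ℝ)) ⊆ g.T X l := by
  subst hI
  have hR := g.exists_mem_R hG l
  exact g.Lam_subset_T hR X C hC _ (MDAG.sterile_subset_bigSymmDiff g hR C A hA)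
    (MDAG.bigSymmDiff_subset g C A _ fun i hi => (hA i hi).2) l hl.1 fun i hi => hl.2 hi
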